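/- Let $0<k\le n$ be integers. Let $St(n,k)=\{U\in\mathbb{R}^{n\times k}: U^TU=I_k\}$ be the Stiefel manifold with the Riemannian metric induced by the Euclidean inner product $\langle X,Y\rangle=\operatorname{tr}(X^TY)$, so that $T_PSt(n,k)=\{X\in\mathbb{R}^{n\times k}: X^TP+P^TX=0\}$, and identify $T_P^*St(n,k)$ with $T_PSt(n,k)$ through this metric. Let $\exp_P:T_PSt(n,k)\to St(n,k)$ be the Riemannian exponential map. Let $St_+(n,k)$ be the set of all $U\in St(n,k)$ with nonnegative entries. For $f:St(n,k)\to\mathbb{R}$ let $$\hat\partial f(P)=\Big\{X\in T_PSt(n,k):\ \liminf_{V\to0,\,V\ne0}\frac{f(\exp_PV)-f(P)-\langle X,V\rangle}{\|V\|}\ge0\Big\}$$ be its Fréchet subdifferential at $P$, and for $P\in St_+(n,k)$ let $$\hat N(P)=\Big\{X\in T_PSt(n,k):\ \limsup_{V\to0,\,V\neq 0,\,\exp_PV\in St_+(n,k)}\frac{\langle X,V\rangle}{\|V\|}\le0\Big\}$$ be the Fréchet normal cone of $St_+(n,k)$ in $St(n,k)$ at $P$ (here $V\in T_PSt(n,k)$).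 For $\beta>0$ let $f_\beta(U)=\|U^-\|_\beta^\beta$ on $St(n,k)$, where $A^-=[\max\{-a_{ij},0\}]$ and $\|A\|_\beta=(\sum_{i,j}|a_{ij}|^\beta)^{1/\beta}$. For $P\in St_+(n,k)$ and $\alpha>0$ consider the inclusion $$\{X\in T_PSt(n,k):\|X\|\le\alpha\}\cap\hat N(P)\subset\hat\partial f_\beta(P).\qquad(*)$$ (The validity of $(*)$ at all $P\in St_+(n,k)$ with a common $\alpha>0$ is the dual necessary condition for $St_+(n,k)$ to be the set of weak sharp minima of $f_\beta$ over $St(n,k)$.) Then: 1. For every $P=[p_{ij}]\in St_+(n,k)$, a tangent vector $X=[x_{ij}]\in T_PSt(n,k)$ belongs to $\hat N(P)$ if and only if, for every row index $i$: if the $i$-th row of $P$ is zero, then $x_{ij}\le0$ for all $j$; and if the $i$-th row of $P$ is non-zero, then $x_{ij}p_{ij}=0$ for all $j$. 2. If $0<\beta<1$, then $(*)$ holds with $\alpha=1$ for every $P\in St_+(n,k)$. 3. If $\beta>1$ and $n\ge2$, then there is $P\in St_+(n,k)$ such that $(*)$ fails for every $\alpha>0$; in particular, the dual necessary condition fails.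 -/

import Mathlib

open scoped Matrix Topology ContDiff

/-! ## Fréchet subdifferential and Fréchet normal cone in a normed space -/

/-- The Fréchet subdifferential of `f : E → ℝ` at `p`: all `x` in the dual `E*` such that
`liminf_{u → p, u ≠ p} (f u - f p - ⟨x, u - p⟩) / ‖u - p‖ ≥ 0` (the lower limit is taken in the
extended reals). -/
def frechetSubdifferential {E : Type*} [NormedAddCommGroup E] [NormedSpace ℝ E]
    (f : E → ℝ) (p : E) : Set (StrongDual ℝ E) :=
  {x | 0 ≤ Filter.liminf
    (fun u : E => (((f u - f p - x (u - p)) / ‖u - p‖ : ℝ) : EReal)) (𝓝[≠] p)}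

/-- The Fréchet normal cone of `Ω ⊆ E` at `p`: all `x` in the dual `E*` such that
`limsup_{u → p, u ∈ Ω, u ≠ p} ⟨x, u - p⟩ / ‖u - p‖ ≤ 0` (the upper limit is taken in the
extended reals, so it is `-∞` at an isolated point of `Ω`). -/
def frechetNormalCone {E : Type*} [NormedAddCommGroup E] [NormedSpace ℝ E]
    (Ω : Set E) (p : E) : Set (StrongDual ℝ E) :=
  {x | Filter.limsup
    (fun u : E => ((x (u - p) / ‖u - p‖ : ℝ) : EReal)) (𝓝[Ω \ {p}] p) ≤ 0}

/-! ## The Stiefel manifold as a Riemannian submanifold of the Euclidean space of matrices -/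

section

open scoped Matrix.Norms.Frobenius

theorem hasDerivAt_matrix_exp_smul {m : ℕ} (W : Matrix (Fin m) (Fin m) ℝ) (t : ℝ) :
    HasDerivAt (fun s : ℝ => NormedSpace.exp (s • W)) (NormedSpace.exp (t • W) * W) t :=
  hasDerivAt_exp_smul_const (𝕂 := ℝ) W t

theorem hasDerivAt_matrix_exp_smul' {m : ℕ} (W : Matrix (Fin m) (Fin m) ℝ) (t : ℝ) :
    HasDerivAt (fun s : ℝ => NormedSpace.exp (s • W)) (W * NormedSpace.exp (t • W)) t :=
  hasDerivAt_exp_smul_const' (𝕂 := ℝ) W t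

end

/-- The Euclidean inner product `⟨X, Y⟩ = tr (Xᵀ Y)` on matrices. -/
@[reducible]
def matrixInnerCore (n k : ℕ) : InnerProductSpace.Core ℝ (Matrix (Fin n) (Fin k) ℝ) where
  inner X Y := (Xᵀ * Y).trace
  conj_inner_symm X Y := by
    simp only [conj_trivial]
    rw [← Matrix.trace_transpose, Matrix.transpose_mul, Matrix.transpose_transpose]
  re_inner_nonneg X := by
    simp only [Matrix.trace, Matrix.diag, Matrix.mul_apply, Matrix.transpose_apply,
      RCLike.re_to_real]
    exact Finset.sum_nonneg fun j _ => Finset.sum_nonneg fun i _ => mul_self_nonneg _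
  add_left X Y Z := by simp [Matrix.add_mul]
  smul_left X Y r := by simp
  definite X h := by
    rw [← Matrix.conjTranspose_eq_transpose_of_trivial] at h
    exact Matrix.trace_conjTranspose_mul_self_eq_zero_iff.1 h

theorem matrixInnerCore_continuousAt (n k : ℕ) :
    ContinuousAt (fun X : Matrix (Fin n) (Fin k) ℝ => (matrixInnerCore n k).inner X X) 0 := by
  have h : Continuous fun X : Matrix (Fin n) (Fin k) ℝ => (Xᵀ * X).trace := by fun_prop
  exact h.continuousAt

theorem matrixInnerCore_isVonNBounded (n k : ℕ) : Bornology.IsVonNBounded ℝ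
    {X : Matrix (Fin n) (Fin k) ℝ | RCLike.re ((matrixInnerCore n k).inner X X) < 1} := by
  refine (Bornology.isVonNBounded_pi_iff (𝕜 := ℝ)).2 fun i =>
    (Bornology.isVonNBounded_pi_iff (𝕜 := ℝ)).2 fun j => ?_
  rw [NormedSpace.isVonNBounded_iff']
  refine ⟨1, ?_⟩
  rintro _ ⟨_, ⟨X, hX, rfl⟩, rfl⟩
  change Matrix (Fin n) (Fin k) ℝ at X
  have hX' : (Xᵀ * X).trace < 1 := hX
  simp only [Matrix.trace, Matrix.diag, Matrix.mul_apply, Matrix.transpose_apply] at hX'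
  have h1 : X i j * X i j ≤ ∑ a, X a j * X a j :=
    Finset.single_le_sum (f := fun a => X a j * X a j) (fun a _ => mul_self_nonneg _)
      (Finset.mem_univ i)
  have h2 : ∑ a, X a j * X a j ≤ ∑ b, ∑ a, X a b * X a b :=
    Finset.single_le_sum (f := fun b => ∑ a, X a b * X a b)
      (fun b _ => Finset.sum_nonneg fun a _ => mul_self_nonneg _) (Finset.mem_univ j)
  change |X i j| ≤ 1
  exact abs_le_one_iff_mul_self_le_one.2 (h1.trans (h2.trans hX'.le))

/-- The Euclidean (Frobenius) norm `‖X‖ = √(tr (Xᵀ X))` on matrices. -/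
noncomputable instance matrixNormedAddCommGroup (n k : ℕ) :
    NormedAddCommGroup (Matrix (Fin n) (Fin k) ℝ) :=
  (matrixInnerCore n k).toNormedAddCommGroupOfTopology
    (matrixInnerCore_continuousAt n k) (matrixInnerCore_isVonNBounded n k)

noncomputable instance matrixInnerProductSpace (n k : ℕ) :
    InnerProductSpace ℝ (Matrix (Fin n) (Fin k) ℝ) :=
  InnerProductSpace.ofCoreOfTopology (matrixInnerCore n k)
    (matrixInnerCore_continuousAt n k) (matrixInnerCore_isVonNBounded n k)

theorem matrix_inner_def {n k : ℕ} (X Y : Matrix (Fin n) (Fin k) ℝ) :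
    inner ℝ X Y = (Xᵀ * Y).trace := rfl

/-- The Stiefel manifold `St(n, k) = {U ∈ ℝ^{n × k} | Uᵀ U = I}`. -/
def stiefelSet (n k : ℕ) : Set (Matrix (Fin n) (Fin k) ℝ) := {U | Uᵀ * U = 1}

/-- The points of the Stiefel manifold, as a type. -/
abbrev Stiefel (n k : ℕ) : Type := {U : Matrix (Fin n) (Fin k) ℝ // U ∈ stiefelSet n k}

/-- The tangent space `T_P St(n, k) = {X | Xᵀ P + Pᵀ X = 0}`, with the inner product
induced from the space of matrices. -/
def stiefelTangent {n k : ℕ} (P : Matrix (Fin n) (Fin k) ℝ) :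
    Submodule ℝ (Matrix (Fin n) (Fin k) ℝ) where
  carrier := {X | Xᵀ * P + Pᵀ * X = 0}
  zero_mem' := by simp
  add_mem' {X Y} hX hY := by
    simp only [Set.mem_ofPred_eq] at hX hY ⊢
    rw [Matrix.transpose_add, Matrix.add_mul, Matrix.mul_add, add_add_add_comm, hX, hY, add_zero]
  smul_mem' c X hX := by
    simp only [Set.mem_ofPred_eq] at hX ⊢
    rw [Matrix.transpose_smul, Matrix.smul_mul, Matrix.mul_smul, ← smul_add, hX, smul_zero]

/-- A (complete) geodesic of the Stiefel manifold with the metric induced from the space of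
matrices: a smooth curve in `St(n, k)` whose covariant acceleration, i.e. the tangential part
of its second derivative, vanishes. -/
structure IsStiefelGeodesic {n k : ℕ} (γ : ℝ → Matrix (Fin n) (Fin k) ℝ) : Prop where
  mem : ∀ t, γ t ∈ stiefelSet n k
  smooth : ContDiff ℝ ∞ γ
  acceleration : ∀ t, ∀ X ∈ stiefelTangent (γ t), inner ℝ (deriv (deriv γ) t) X = 0

/-! ### Existence and uniqueness of geodesics

The geodesic with initial point `P` and initial velocity `V` is
`t ↦ exp (t (V Pᵀ - P Vᵀ)) P exp (-t Pᵀ V)`. -/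

theorem isBoundedBilinearMap_matrix_mul (l m n : ℕ) : IsBoundedBilinearMap ℝ
    (fun p : Matrix (Fin l) (Fin m) ℝ × Matrix (Fin m) (Fin n) ℝ => p.1 * p.2) :=
  (LinearMap.toContinuousBilinearMap (LinearMap.mk₂ ℝ
    (fun (A : Matrix (Fin l) (Fin m) ℝ) (B : Matrix (Fin m) (Fin n) ℝ) => A * B)
    Matrix.add_mul (fun c A B => Matrix.smul_mul c A B) Matrix.mul_add
    (fun c A B => Matrix.mul_smul A c B))).isBoundedBilinearMap

theorem contDiff_matrix_mul {l m n : ℕ} {A : ℝ → Matrix (Fin l) (Fin m) ℝ}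
    {B : ℝ → Matrix (Fin m) (Fin n) ℝ} (hA : ContDiff ℝ ∞ A) (hB : ContDiff ℝ ∞ B) :
    ContDiff ℝ ∞ (fun s => A s * B s) :=
  (isBoundedBilinearMap_matrix_mul l m n).contDiff.comp (hA.prodMk hB)

theorem hasDerivAt_matrix_mul {l m n : ℕ} {A : ℝ → Matrix (Fin l) (Fin m) ℝ}
    {B : ℝ → Matrix (Fin m) (Fin n) ℝ} {A' : Matrix (Fin l) (Fin m) ℝ}
    {B' : Matrix (Fin m) (Fin n) ℝ} {t : ℝ} (hA : HasDerivAt A A' t) (hB : HasDerivAt B B' t) :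
    HasDerivAt (fun s => A s * B s) (A' * B t + A t * B') t := by
  have := ((isBoundedBilinearMap_matrix_mul l m n).hasFDerivAt (A t, B t)).comp_hasDerivAt t (hA.prodMk hB)
  rw [add_comm]
  exact this

theorem hasDerivAt_matrix_transpose {m n : ℕ} {A : ℝ → Matrix (Fin m) (Fin n) ℝ}
    {A' : Matrix (Fin m) (Fin n) ℝ} {t : ℝ} (hA : HasDerivAt A A' t) :
    HasDerivAt (fun s => (A s)ᵀ) A'ᵀ t := by
  have := (LinearMap.toContinuousLinearMap
    (Matrix.transposeLinearEquiv (Fin m) (Fin n) ℝ ℝ).toLinearMap).hasFDerivAt.comp_hasDerivAt t hA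
  exact this

/-- The exponential formula for the geodesics of the Stiefel manifold. -/
noncomputable def stiefelGeodesic {n k : ℕ} (P V : Matrix (Fin n) (Fin k) ℝ) (t : ℝ) :
    Matrix (Fin n) (Fin k) ℝ :=
  NormedSpace.exp (t • (V * Pᵀ - P * Vᵀ)) * P * NormedSpace.exp (t • (-(Pᵀ * V)))

theorem contDiff_matrix_exp_smul {m : ℕ} (W : Matrix (Fin m) (Fin m) ℝ) :
    ContDiff ℝ ∞ (fun s : ℝ => NormedSpace.exp (s • W)) := by
  have hd : deriv (fun s : ℝ => NormedSpace.exp (s • W)) =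
      fun s : ℝ => NormedSpace.exp (s • W) * W :=
    funext fun s => (hasDerivAt_matrix_exp_smul W s).deriv
  have h : ∀ N : ℕ, ContDiff ℝ N (fun s : ℝ => NormedSpace.exp (s • W)) := by
    intro N
    induction N with
    | zero => exact contDiff_zero.2 (continuous_iff_continuousAt.2 fun s =>
        (hasDerivAt_matrix_exp_smul W s).continuousAt)
    | succ N ih =>
      rw [Nat.cast_succ]
      refine contDiff_succ_iff_deriv.2
        ⟨fun s => (hasDerivAt_matrix_exp_smul W s).differentiableAt, fun h => by simp at h, ?_⟩
      rw [hd]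
      exact (isBoundedBilinearMap_matrix_mul m m m).contDiff.comp (ih.prodMk contDiff_const)
  exact contDiff_infty.2 h

theorem hasDerivAt_stiefelGeodesic_aux {n k : ℕ} (W : Matrix (Fin n) (Fin n) ℝ)
    (B : Matrix (Fin k) (Fin k) ℝ) (Z : Matrix (Fin n) (Fin k) ℝ) (t : ℝ) :
    HasDerivAt (fun s : ℝ => NormedSpace.exp (s • W) * Z * NormedSpace.exp (s • B))
      (NormedSpace.exp (t • W) * (W * Z + Z * B) * NormedSpace.exp (t • B)) t := by
  have h1 := hasDerivAt_matrix_exp_smul W t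
  have h2 := hasDerivAt_matrix_exp_smul' B t
  have h3 := hasDerivAt_matrix_mul
    (hasDerivAt_matrix_mul h1 (hasDerivAt_const t Z)) h2
  refine h3.congr_deriv ?_
  rw [Matrix.mul_zero, add_zero]
  simp only [Matrix.mul_add, Matrix.add_mul, Matrix.mul_assoc]

theorem exp_skew_transpose_mul {m : ℕ} {W : Matrix (Fin m) (Fin m) ℝ} (hW : Wᵀ = -W) (t : ℝ) :
    (NormedSpace.exp (t • W))ᵀ * NormedSpace.exp (t • W) = 1 := by
  rw [← Matrix.exp_transpose, Matrix.transpose_smul, hW,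
    ← Matrix.exp_add_of_commute _ _ (by simp), smul_neg, neg_add_cancel,
    NormedSpace.exp_zero]

theorem transpose_skew {n k : ℕ} (P V : Matrix (Fin n) (Fin k) ℝ) :
    (V * Pᵀ - P * Vᵀ)ᵀ = -(V * Pᵀ - P * Vᵀ) := by
  simp [Matrix.transpose_sub, Matrix.transpose_mul]

theorem stiefelTangent_skew {n k : ℕ} {P V : Matrix (Fin n) (Fin k) ℝ}
    (hV : V ∈ stiefelTangent P) : Vᵀ * P = -(Pᵀ * V) := eq_neg_of_add_eq_zero_left hV

theorem stiefelGeodesic_zero {n k : ℕ} (P V : Matrix (Fin n) (Fin k) ℝ) :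
    stiefelGeodesic P V 0 = P := by simp [stiefelGeodesic]

theorem hasDerivAt_stiefelGeodesic {n k : ℕ} {P V : Matrix (Fin n) (Fin k) ℝ}
    (hP : P ∈ stiefelSet n k) (hV : V ∈ stiefelTangent P) (t : ℝ) :
    HasDerivAt (stiefelGeodesic P V) (NormedSpace.exp (t • (V * Pᵀ - P * Vᵀ)) * V *
      NormedSpace.exp (t • (-(Pᵀ * V)))) t := by
  have h := hasDerivAt_stiefelGeodesic_aux (V * Pᵀ - P * Vᵀ) (-(Pᵀ * V)) P t
  have hP' : Pᵀ * P = 1 := hP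
  have e : (V * Pᵀ - P * Vᵀ) * P + P * -(Pᵀ * V) = V := by
    rw [Matrix.sub_mul, Matrix.mul_assoc V, hP', Matrix.mul_one, Matrix.mul_assoc P,
      stiefelTangent_skew hV]
    simp
  rwa [e] at h

theorem deriv_stiefelGeodesic_zero {n k : ℕ} {P V : Matrix (Fin n) (Fin k) ℝ}
    (hP : P ∈ stiefelSet n k) (hV : V ∈ stiefelTangent P) :
    deriv (stiefelGeodesic P V) 0 = V :=
  Eq.trans (hasDerivAt_stiefelGeodesic hP hV 0).deriv (by simp)

theorem deriv_deriv_stiefelGeodesic {n k : ℕ} {P V : Matrix (Fin n) (Fin k) ℝ}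
    (hP : P ∈ stiefelSet n k) (hV : V ∈ stiefelTangent P) (t : ℝ) :
    deriv (deriv (stiefelGeodesic P V)) t = -(NormedSpace.exp (t • (V * Pᵀ - P * Vᵀ)) *
      (P * (Vᵀ * V)) * NormedSpace.exp (t • (-(Pᵀ * V)))) := by
  have h1 : deriv (stiefelGeodesic P V) = fun s : ℝ =>
      NormedSpace.exp (s • (V * Pᵀ - P * Vᵀ)) * V * NormedSpace.exp (s • (-(Pᵀ * V))) :=
    funext fun s => (hasDerivAt_stiefelGeodesic hP hV s).deriv
  rw [h1]
  refine Eq.trans (hasDerivAt_stiefelGeodesic_aux (V * Pᵀ - P * Vᵀ) (-(Pᵀ * V)) V t).deriv ?_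
  have e : (V * Pᵀ - P * Vᵀ) * V + V * -(Pᵀ * V) = -(P * (Vᵀ * V)) := by
    simp only [Matrix.sub_mul, Matrix.mul_assoc, Matrix.mul_neg]
    abel
  rw [e]
  simp

theorem inner_mul_symm_eq_zero {n k : ℕ} {P X : Matrix (Fin n) (Fin k) ℝ}
    {S : Matrix (Fin k) (Fin k) ℝ} (hS : Sᵀ = S) (hX : X ∈ stiefelTangent P) :
    inner ℝ (P * S) X = 0 := by
  have h1 : inner ℝ (P * S) X = (S * (Pᵀ * X)).trace := by
    rw [matrix_inner_def, Matrix.transpose_mul, hS, Matrix.mul_assoc]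
  have h2 : (S * (Pᵀ * X)).trace = -(S * (Pᵀ * X)).trace := by
    conv_lhs => rw [← Matrix.trace_transpose, Matrix.transpose_mul, hS, Matrix.transpose_mul,
      Matrix.transpose_transpose, Matrix.trace_mul_comm, stiefelTangent_skew hX]
    simp
  rw [h1]
  linarith

theorem exists_symm_of_normal {n k : ℕ} {P Z : Matrix (Fin n) (Fin k) ℝ}
    (hP : Pᵀ * P = 1) (hZ : ∀ X ∈ stiefelTangent P, inner ℝ Z X = 0) :
    ∃ S : Matrix (Fin k) (Fin k) ℝ, Sᵀ = S ∧ Z = P * S := by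
  set S : Matrix (Fin k) (Fin k) ℝ := (1 / 2 : ℝ) • (Pᵀ * Z + Zᵀ * P) with hSdef
  have hS : Sᵀ = S := by
    rw [hSdef]
    simp [Matrix.transpose_mul, add_comm]
  have hX : Z - P * S ∈ stiefelTangent P := by
    change (Z - P * S)ᵀ * P + Pᵀ * (Z - P * S) = 0
    rw [Matrix.transpose_sub, Matrix.transpose_mul, hS, Matrix.sub_mul, Matrix.mul_sub,
      Matrix.mul_assoc, hP, Matrix.mul_one, ← Matrix.mul_assoc, hP, Matrix.one_mul]
    have : S + S = Pᵀ * Z + Zᵀ * P := by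
      rw [hSdef, ← add_smul]; norm_num
    calc Zᵀ * P - S + (Pᵀ * Z - S) = Pᵀ * Z + Zᵀ * P - (S + S) := by abel
      _ = 0 := by rw [this, sub_self]
  have h0 : inner ℝ (Z - P * S) (Z - P * S) = 0 := by
    rw [inner_sub_left, hZ _ hX, inner_mul_symm_eq_zero hS hX, sub_zero]
  exact ⟨S, hS, sub_eq_zero.1 (inner_self_eq_zero.1 h0)⟩

theorem eq_of_hasDerivAt_zero {n k : ℕ} {f : ℝ → Matrix (Fin n) (Fin k) ℝ}
    (hf : ∀ t, HasDerivAt f 0 t) (t : ℝ) : f t = f 0 :=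
  is_const_of_deriv_eq_zero (fun s => (hf s).differentiableAt) (fun s => (hf s).deriv) t 0

theorem isStiefelGeodesic_stiefelGeodesic {n k : ℕ} {P V : Matrix (Fin n) (Fin k) ℝ}
    (hP : P ∈ stiefelSet n k) (hV : V ∈ stiefelTangent P) :
    IsStiefelGeodesic (stiefelGeodesic P V) := by
  have hP' : Pᵀ * P = 1 := hP
  have hA : (-(Pᵀ * V))ᵀ = -(-(Pᵀ * V)) := by
    rw [Matrix.transpose_neg, Matrix.transpose_mul, Matrix.transpose_transpose,
      stiefelTangent_skew hV]
  have hW := exp_skew_transpose_mul (transpose_skew P V)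
  have hB := exp_skew_transpose_mul hA
  have hmem : ∀ t, (stiefelGeodesic P V t)ᵀ * stiefelGeodesic P V t = 1 := by
    intro t
    set E := NormedSpace.exp (t • (V * Pᵀ - P * Vᵀ)) with hE
    set F := NormedSpace.exp (t • (-(Pᵀ * V))) with hF
    calc (E * P * F)ᵀ * (E * P * F) = Fᵀ * (Pᵀ * ((Eᵀ * E) * P)) * F := by
          simp only [Matrix.transpose_mul, Matrix.mul_assoc]
      _ = 1 := by rw [hW t, Matrix.one_mul, hP', Matrix.mul_one, hB t]
  refine ⟨hmem, ?_, ?_⟩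
  · exact contDiff_matrix_mul (contDiff_matrix_mul (contDiff_matrix_exp_smul _) contDiff_const)
      (contDiff_matrix_exp_smul _)
  · intro t X hX
    have hF := mul_eq_one_comm.1 (hB t)
    rw [deriv_deriv_stiefelGeodesic hP hV]
    have h := inner_mul_symm_eq_zero (P := stiefelGeodesic P V t)
      (S := (NormedSpace.exp (t • (-(Pᵀ * V))))ᵀ * (Vᵀ * V) * NormedSpace.exp (t • (-(Pᵀ * V))))
      (by simp [Matrix.transpose_mul, Matrix.mul_assoc]) hX
    rw [inner_neg_left, neg_eq_zero]
    convert h using 2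
    set E := NormedSpace.exp (t • (V * Pᵀ - P * Vᵀ)) with hE
    set F := NormedSpace.exp (t • (-(Pᵀ * V))) with hFdef
    calc E * (P * (Vᵀ * V)) * F = E * (P * (1 * (Vᵀ * V))) * F := by rw [Matrix.one_mul]
      _ = E * (P * ((F * Fᵀ) * (Vᵀ * V))) * F := by rw [hF]
      _ = E * P * F * (Fᵀ * (Vᵀ * V) * F) := by simp only [Matrix.mul_assoc]

theorem acceleration_eq {n k : ℕ} {γ : ℝ → Matrix (Fin n) (Fin k) ℝ} (hγ : IsStiefelGeodesic γ)
    (t : ℝ) : deriv (deriv γ) t = -(γ t * ((deriv γ t)ᵀ * deriv γ t)) := by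
  have hd : ∀ s, HasDerivAt γ (deriv γ s) s := fun s =>
    ((hγ.smooth.differentiable (by simp)) s).hasDerivAt
  have hd2 : ∀ s, HasDerivAt (deriv γ) (deriv (deriv γ) s) s := fun s =>
    (((contDiff_infty_iff_deriv.1 hγ.smooth).2.differentiable (by simp)) s).hasDerivAt
  have hm : (γ t)ᵀ * γ t = 1 := hγ.mem t
  obtain ⟨S, hS, hZ⟩ := exists_symm_of_normal hm (hγ.acceleration t)
  have h1 : ∀ s, (deriv γ s)ᵀ * γ s + (γ s)ᵀ * deriv γ s = 0 := fun s => by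
    have h := hasDerivAt_matrix_mul (hasDerivAt_matrix_transpose (hd s)) (hd s)
    have hc : (fun u => (γ u)ᵀ * γ u) = fun _ => (1 : Matrix (Fin k) (Fin k) ℝ) :=
      funext fun u => hγ.mem u
    rw [hc] at h
    exact h.unique (hasDerivAt_const s _)
  have h2 := (hasDerivAt_matrix_mul (hasDerivAt_matrix_transpose (hd2 t)) (hd t)).add
    (hasDerivAt_matrix_mul (hasDerivAt_matrix_transpose (hd t)) (hd2 t))
  have hc : ((fun s => (deriv γ s)ᵀ * γ s) + fun s => (γ s)ᵀ * deriv γ s) =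
      fun _ => (0 : Matrix (Fin k) (Fin k) ℝ) := funext h1
  rw [hc] at h2
  have h3 := h2.unique (hasDerivAt_const t _)
  rw [hZ, Matrix.transpose_mul, hS, Matrix.mul_assoc, hm, Matrix.mul_one, ← Matrix.mul_assoc, hm,
    Matrix.one_mul] at h3
  have h4 : S = -((deriv γ t)ᵀ * deriv γ t) := by
    have h5 : (2 : ℝ) • (S + (deriv γ t)ᵀ * deriv γ t) = 0 := by
      rw [two_smul, ← h3]; abel
    exact eq_neg_of_add_eq_zero_left ((smul_eq_zero.1 h5).resolve_left two_ne_zero)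
  rw [hZ, h4, Matrix.mul_neg]

/-- Every geodesic is given by the exponential formula, and hence it is determined by its initial
point and its initial velocity. -/
theorem IsStiefelGeodesic.eq_stiefelGeodesic {n k : ℕ} {γ : ℝ → Matrix (Fin n) (Fin k) ℝ}
    (hγ : IsStiefelGeodesic γ) (t : ℝ) : γ t = stiefelGeodesic (γ 0) (deriv γ 0) t := by
  have hd : ∀ s, HasDerivAt γ (deriv γ s) s := fun s =>
    ((hγ.smooth.differentiable (by simp)) s).hasDerivAt
  have hd2 : ∀ s, HasDerivAt (deriv γ) (deriv (deriv γ) s) s := fun s =>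
    (((contDiff_infty_iff_deriv.1 hγ.smooth).2.differentiable (by simp)) s).hasDerivAt
  have hm : ∀ s, (γ s)ᵀ * γ s = 1 := hγ.mem
  -- both `γ' γᵀ - γ γ'ᵀ` and `γᵀ γ'` are constant
  have hW : ∀ s, deriv γ s * (γ s)ᵀ - γ s * (deriv γ s)ᵀ
      = deriv γ 0 * (γ 0)ᵀ - γ 0 * (deriv γ 0)ᵀ := fun s => by
    refine eq_of_hasDerivAt_zero (f := fun s => deriv γ s * (γ s)ᵀ - γ s * (deriv γ s)ᵀ)
      (fun u => ?_) s
    have h := (hasDerivAt_matrix_mul (hd2 u) (hasDerivAt_matrix_transpose (hd u))).sub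
      (hasDerivAt_matrix_mul (hd u) (hasDerivAt_matrix_transpose (hd2 u)))
    refine h.congr_deriv ?_
    rw [acceleration_eq hγ]
    simp only [Matrix.transpose_mul, Matrix.transpose_neg, Matrix.transpose_transpose,
      Matrix.mul_neg, Matrix.neg_mul, Matrix.mul_assoc]
    abel
  have hA : ∀ s, (γ s)ᵀ * deriv γ s = (γ 0)ᵀ * deriv γ 0 := fun s => by
    refine eq_of_hasDerivAt_zero (f := fun s => (γ s)ᵀ * deriv γ s) (fun u => ?_) s
    have h := hasDerivAt_matrix_mul (hasDerivAt_matrix_transpose (hd u)) (hd2 u)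
    refine h.congr_deriv ?_
    rw [acceleration_eq hγ, Matrix.mul_neg, ← Matrix.mul_assoc, hm, Matrix.one_mul, add_neg_cancel]
  have hT : ∀ s, (deriv γ s)ᵀ * γ s = -((γ s)ᵀ * deriv γ s) := fun s => by
    have h := hasDerivAt_matrix_mul (hasDerivAt_matrix_transpose (hd s)) (hd s)
    have hc : (fun u => (γ u)ᵀ * γ u) = fun _ => (1 : Matrix (Fin k) (Fin k) ℝ) := funext hm
    rw [hc] at h
    exact eq_neg_of_add_eq_zero_left (h.unique (hasDerivAt_const s _))
  set W := deriv γ 0 * (γ 0)ᵀ - γ 0 * (deriv γ 0)ᵀ with hWdef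
  set A := (γ 0)ᵀ * deriv γ 0 with hAdef
  have hlin : ∀ s, deriv γ s = W * γ s - γ s * A := fun s => by
    rw [← hW s, ← hA s, Matrix.sub_mul, Matrix.mul_assoc, hm, Matrix.mul_one, Matrix.mul_assoc,
      hT s]
    simp
  have hconst : ∀ s, NormedSpace.exp (s • (-W)) * γ s * NormedSpace.exp (s • A) = γ 0 := fun s => by
    have := eq_of_hasDerivAt_zero
      (f := fun s => NormedSpace.exp (s • (-W)) * γ s * NormedSpace.exp (s • A)) (fun u => ?_) s
    · simpa using this
    · have h := hasDerivAt_matrix_mul (hasDerivAt_matrix_mul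
        (hasDerivAt_matrix_exp_smul (-W) u) (hd u))
        (hasDerivAt_matrix_exp_smul' A u)
      refine h.congr_deriv ?_
      rw [hlin u]
      simp only [Matrix.mul_sub, Matrix.add_mul, Matrix.sub_mul, Matrix.mul_assoc, Matrix.mul_neg,
        Matrix.neg_mul]
      abel
  have hinv : ∀ (m : ℕ) (B : Matrix (Fin m) (Fin m) ℝ),
      NormedSpace.exp (t • B) * NormedSpace.exp (t • (-B)) = 1 := fun m B => by
    rw [← Matrix.exp_add_of_commute _ _ (by simp), smul_neg,
      add_neg_cancel, NormedSpace.exp_zero]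
  have h := hconst t
  unfold stiefelGeodesic
  rw [← hWdef, ← hAdef, ← h]
  set E := NormedSpace.exp (t • W)
  set E' := NormedSpace.exp (t • (-W))
  set F := NormedSpace.exp (t • A)
  set F' := NormedSpace.exp (t • (-A))
  calc γ t = ((1 : Matrix (Fin n) (Fin n) ℝ) * γ t) * (1 : Matrix (Fin k) (Fin k) ℝ) := by rw [Matrix.one_mul, Matrix.mul_one]
    _ = ((E * E') * γ t) * (F * F') := by rw [hinv, hinv]
    _ = E * (E' * γ t * F) * F' := by simp only [Matrix.mul_assoc]

theorem exists_stiefelGeodesic {n k : ℕ} (P : Stiefel n k) (V : stiefelTangent P.1) :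
    ∃ γ : ℝ → Matrix (Fin n) (Fin k) ℝ, IsStiefelGeodesic γ ∧ γ 0 = P.1 ∧ deriv γ 0 = V.1 :=
  ⟨stiefelGeodesic P.1 V.1, isStiefelGeodesic_stiefelGeodesic P.2 V.2, stiefelGeodesic_zero _ _,
    deriv_stiefelGeodesic_zero P.2 V.2⟩

/-- The Riemannian exponential map `exp_P : T_P St(n, k) → St(n, k)`: `exp_P V = γ 1`, where `γ`
is the geodesic with `γ 0 = P` and `γ' 0 = V`. -/
noncomputable def stiefelExp {n k : ℕ} (P : Stiefel n k) (V : stiefelTangent P.1) : Stiefel n k :=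
  ⟨(exists_stiefelGeodesic P V).choose 1, (exists_stiefelGeodesic P V).choose_spec.1.mem 1⟩

theorem stiefelExp_eq_of_isStiefelGeodesic {n k : ℕ} (P : Stiefel n k) (V : stiefelTangent P.1)
    {γ : ℝ → Matrix (Fin n) (Fin k) ℝ} (hγ : IsStiefelGeodesic γ) (h0 : γ 0 = P.1)
    (h1 : deriv γ 0 = V.1) : (stiefelExp P V).1 = γ 1 := by
  obtain ⟨g, g0, g1⟩ := (exists_stiefelGeodesic P V).choose_spec
  change (exists_stiefelGeodesic P V).choose 1 = γ 1
  rw [g.eq_stiefelGeodesic, g0, g1, hγ.eq_stiefelGeodesic, h0, h1]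

theorem stiefelExp_eq {n k : ℕ} (P : Stiefel n k) (V : stiefelTangent P.1) :
    (stiefelExp P V).1 = NormedSpace.exp (V.1 * P.1ᵀ - P.1 * V.1ᵀ) * P.1 *
      NormedSpace.exp (-(P.1ᵀ * V.1)) := by
  rw [stiefelExp_eq_of_isStiefelGeodesic P V (isStiefelGeodesic_stiefelGeodesic P.2 V.2)
    (stiefelGeodesic_zero _ _) (deriv_stiefelGeodesic_zero P.2 V.2)]
  simp [stiefelGeodesic]

/-! ## Variational notions on the Stiefel manifold

As usual, a Riemannian notion at `P` is the corresponding notion at `0 ∈ T_P St(n, k)` of the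
pull-back under `exp_P`, and `T_P* St(n, k)` is identified with `T_P St(n, k)` through the
Riemannian metric. -/

/-- The Fréchet subdifferential of `f : St(n, k) → ℝ` at `P`. -/
noncomputable def stiefelSubdifferential {n k : ℕ} (f : Stiefel n k → ℝ) (P : Stiefel n k) :
    Set (stiefelTangent P.1) :=
  {X | innerSL ℝ X ∈ frechetSubdifferential (fun V => f (stiefelExp P V)) 0}

/-- The Fréchet normal cone of `Ω ⊆ St(n, k)` at `P`. -/
noncomputable def stiefelNormalCone {n k : ℕ} (Ω : Set (Stiefel n k)) (P : Stiefel n k) :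
    Set (stiefelTangent P.1) :=
  {X | innerSL ℝ X ∈ frechetNormalCone {V | stiefelExp P V ∈ Ω} 0}

/-! ## The problem -/

/-- `St₊(n, k)`: the points of the Stiefel manifold with nonnegative entries. -/
def stiefelNonneg (n k : ℕ) : Set (Stiefel n k) := {U | ∀ i j, 0 ≤ U.1 i j}

/-- `‖A‖_β = (∑ |a_{ij}|^β)^{1/β}`. -/
noncomputable def entrywiseNorm {n k : ℕ} (β : ℝ) (A : Matrix (Fin n) (Fin k) ℝ) : ℝ :=
  (∑ i, ∑ j, |A i j| ^ β) ^ (1 / β)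

/-- `A⁻ = [max {-a_{ij}, 0}]`. -/
def negPartMatrix {n k : ℕ} (A : Matrix (Fin n) (Fin k) ℝ) : Matrix (Fin n) (Fin k) ℝ :=
  Matrix.of fun i j => max (-A i j) 0

/-- `f_β(U) = ‖U⁻‖_β^β` on `St(n, k)`. -/
noncomputable def fBeta {n k : ℕ} (β : ℝ) (U : Stiefel n k) : ℝ :=
  entrywiseNorm β (negPartMatrix U.1) ^ β

/-- The dual necessary condition at `P` with constant `α`, for `St₊(n, k)` to be the set of weak
sharp minima of `f_β` over `St(n, k)`:
`α 𝔹 ∩ N̂(P) ⊆ ∂̂ f_β(P)`, where `𝔹` is the closed unit ball of `T_P St(n, k)`. -/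
def DualNecessaryCondition {n k : ℕ} (β α : ℝ) (P : Stiefel n k) : Prop :=
  Metric.closedBall (0 : stiefelTangent P.1) α ∩ stiefelNormalCone (stiefelNonneg n k) P ⊆
    stiefelSubdifferential (fBeta β) P

/-!
In exponential coordinates `exp_P V = P + V + o(‖V‖)`, because the matrix exponential has derivative
the identity at `0` (`hasFDerivAt_stiefelExp`). Everything else is a first-order comparison of
`⟨X, V⟩` with `U - P`, where `U = exp_P V`.

The main estimate is `mul_apply_le_negMass_add_sq`. A nonnegative `P` with orthonormal columns has
columns of disjoint supports. If `p_{ij} > 0` and `l ≠ j`, orthogonality of the columns `j` and `l`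
of `U` bounds `u_{il}` from above by the sum `N(U)` of the entries of `U⁻`, up to `‖U - P‖²`.
Hence, if `X` satisfies the sign conditions of the normal cone, then
`⟨X, V⟩ ≤ C N(exp_P V) + o(‖V‖)` (`exists_eventually_inner_le`). This has two consequences:

* on `St₊(n, k)` the term `N` vanishes, so the sign conditions are sufficient for `X ∈ N̂(P)`;
* for `β < 1` one has `C u ≤ u ^ β` for small `u ≥ 0`, so `C N ≤ f_β` near `P`, and every vector
  that satisfies the sign conditions is a Fréchet subgradient of `f_β`, whatever its norm.

The sign conditions are necessary because of the geodesics that rotate one column `p_j` in the plane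
spanned by `p_j` and a vector `w` orthogonal to all columns of `P` (`stiefelGeodesic_eq_rotation`).
Such a geodesic starts inside `St₊(n, k)` as soon as `w ≥ 0` off the support of `p_j`, and then
`⟨x_j, w⟩ ≤ 0`. A coordinate vector of a zero row, and the restriction of `x_j` to the support of
`p_j`, are admissible choices of `w`, and yield the two conditions.

For `β > 1`, `f_β` is `o(‖V‖)` at every point of `St₊(n, k)`, so its only Fréchet subgradient there
is `0` (`eq_zero_of_mem_stiefelSubdifferential`), whereas the normal cone at `[I; 0]` is
nontrivial (`exists_normalConeCondition_ne_zero`).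
-/

/-! ### Epsilon characterizations of the Fréchet subdifferential and normal cone -/

theorem mem_frechetSubdifferential_iff {E : Type*} [NormedAddCommGroup E] [NormedSpace ℝ E]
    {f : E → ℝ} {p : E} {x : StrongDual ℝ E} :
    x ∈ frechetSubdifferential f p ↔
      ∀ ε > 0, ∀ᶠ u in 𝓝 p, x (u - p) - ε * ‖u - p‖ ≤ f u - f p := by
  unfold frechetSubdifferential
  rw [Set.mem_ofPred_eq, Filter.le_liminf_iff]
  constructor
  · intro h ε hε
    have h1 := h ((-ε : ℝ) : EReal) (by exact_mod_cast neg_lt_zero.2 hε)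
    filter_upwards [eventually_nhdsWithin_iff.1 h1] with u hu
    rcases eq_or_ne u p with rfl | hne
    · simp
    · have h2 := EReal.coe_lt_coe_iff.1 (hu hne)
      rw [lt_div_iff₀ (norm_pos_iff.2 (sub_ne_zero.2 hne))] at h2
      linarith
  · intro h y hy
    obtain ⟨r, hyr, hr⟩ := EReal.lt_iff_exists_real_btwn.1 hy
    have hr' : r < 0 := by exact_mod_cast hr
    refine eventually_nhdsWithin_iff.2 ?_
    filter_upwards [h (-r) (neg_pos.2 hr')] with u hu hne
    refine hyr.trans_le (EReal.coe_le_coe_iff.2 ?_)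
    rw [le_div_iff₀ (norm_pos_iff.2 (sub_ne_zero.2 hne))]
    linarith

theorem mem_frechetNormalCone_iff {E : Type*} [NormedAddCommGroup E] [NormedSpace ℝ E]
    {Ω : Set E} {p : E} {x : StrongDual ℝ E} :
    x ∈ frechetNormalCone Ω p ↔
      ∀ ε > 0, ∀ᶠ u in 𝓝 p, u ∈ Ω → x (u - p) ≤ ε * ‖u - p‖ := by
  unfold frechetNormalCone
  rw [Set.mem_ofPred_eq, Filter.limsup_le_iff]
  constructor
  · intro h ε hε
    have h1 := h (ε : EReal) (by exact_mod_cast hε)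
    filter_upwards [eventually_nhdsWithin_iff.1 h1] with u hu huΩ
    rcases eq_or_ne u p with rfl | hne
    · simp
    · have h2 := EReal.coe_lt_coe_iff.1 (hu ⟨huΩ, hne⟩)
      rw [div_lt_iff₀ (norm_pos_iff.2 (sub_ne_zero.2 hne))] at h2
      exact h2.le
  · intro h y hy
    obtain ⟨r, hr, hry⟩ := EReal.lt_iff_exists_real_btwn.1 hy
    have hr' : 0 < r := by exact_mod_cast hr
    refine eventually_nhdsWithin_iff.2 ?_
    filter_upwards [h r hr'] with u hu huΩ
    refine lt_of_le_of_lt (EReal.coe_le_coe_iff.2 ?_) hry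
    rw [div_le_iff₀ (norm_pos_iff.2 (sub_ne_zero.2 huΩ.2))]
    exact hu huΩ.1

/-! ### First-order expansion of the exponential map -/

section

open scoped Matrix.Norms.Frobenius

theorem hasFDerivAt_matrix_exp_zero (m : ℕ) :
    HasFDerivAt (NormedSpace.exp : Matrix (Fin m) (Fin m) ℝ → Matrix (Fin m) (Fin m) ℝ)
      (ContinuousLinearMap.id ℝ (Matrix (Fin m) (Fin m) ℝ)) 0 := by
  refine @hasFDerivAt_exp_zero ℝ (Matrix (Fin m) (Fin m) ℝ) _ Matrix.frobeniusNormedRing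
    Matrix.frobeniusNormedAlgebra ?_
  exact Matrix.instCompleteSpace _ _ _

end

theorem stiefelExp_zero {n k : ℕ} (P : Stiefel n k) : stiefelExp P 0 = P :=
  Subtype.ext (by simp [stiefelExp_eq])

/-- `exp_P V = P + V + o(‖V‖)`. -/
theorem hasFDerivAt_stiefelExp {n k : ℕ} (P : Stiefel n k) :
    HasFDerivAt (fun V : stiefelTangent P.1 => (stiefelExp P V).1)
      (stiefelTangent P.1).subtypeL 0 := by
  let A : stiefelTangent P.1 →ₗ[ℝ] Matrix (Fin n) (Fin n) ℝ :=
    { toFun := fun V => V.1 * P.1ᵀ - P.1 * V.1ᵀ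
      map_add' := fun V W => by
        simp only [Submodule.coe_add, Matrix.transpose_add, Matrix.add_mul, Matrix.mul_add]
        abel
      map_smul' := fun c V => by simp [smul_sub] }
  let B : stiefelTangent P.1 →ₗ[ℝ] Matrix (Fin k) (Fin k) ℝ :=
    { toFun := fun V => -(P.1ᵀ * V.1)
      map_add' := fun V W => by
        simp only [Submodule.coe_add, Matrix.mul_add, neg_add]
      map_smul' := fun c V => by simp }
  have hA : HasFDerivAt (fun V : stiefelTangent P.1 => NormedSpace.exp (A V))
      (LinearMap.toContinuousLinearMap A) 0 := by
    have h := hasFDerivAt_matrix_exp_zero n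
    rw [← map_zero A] at h
    exact h.comp (0 : stiefelTangent P.1) (LinearMap.toContinuousLinearMap A).hasFDerivAt
  have hB : HasFDerivAt (fun V : stiefelTangent P.1 => NormedSpace.exp (B V))
      (LinearMap.toContinuousLinearMap B) 0 := by
    have h := hasFDerivAt_matrix_exp_zero k
    rw [← map_zero B] at h
    exact h.comp (0 : stiefelTangent P.1) (LinearMap.toContinuousLinearMap B).hasFDerivAt
  have h1 := ((isBoundedBilinearMap_matrix_mul n n k).hasFDerivAt
    (NormedSpace.exp (A 0), P.1)).comp (0 : stiefelTangent P.1)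
    (hA.prodMk (hasFDerivAt_const P.1 _))
  have h2 := ((isBoundedBilinearMap_matrix_mul n k k).hasFDerivAt
    (NormedSpace.exp (A 0) * P.1, NormedSpace.exp (B 0))).comp (0 : stiefelTangent P.1)
    (h1.prodMk hB)
  have hfun : (fun V : stiefelTangent P.1 => (stiefelExp P V).1) =
      fun V => NormedSpace.exp (A V) * P.1 * NormedSpace.exp (B V) :=
    funext fun V => stiefelExp_eq P V
  rw [hfun]
  refine h2.congr_fderiv ?_
  ext1 V
  have hP : P.1ᵀ * P.1 = 1 := P.2
  have e : (V.1 * P.1ᵀ - P.1 * V.1ᵀ) * P.1 + P.1 * -(P.1ᵀ * V.1) = V.1 := by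
    rw [Matrix.sub_mul, Matrix.mul_assoc V.1, hP, Matrix.mul_one, Matrix.mul_assoc P.1,
      stiefelTangent_skew V.2]
    simp
  simpa [IsBoundedBilinearMap.deriv_apply, A, B, add_comm] using e

theorem stiefelExp_smul {n k : ℕ} (P : Stiefel n k) (V : stiefelTangent P.1) (t : ℝ) :
    (stiefelExp P (t • V)).1 = stiefelGeodesic P.1 V.1 t := by
  simp [stiefelExp_eq, stiefelGeodesic, smul_sub]

/-! ### Entries of nonnegative matrices with orthonormal columns -/

theorem matrix_inner_eq_sum {n k : ℕ} (X Y : Matrix (Fin n) (Fin k) ℝ) :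
    inner ℝ X Y = ∑ i, ∑ j, X i j * Y i j := by
  rw [matrix_inner_def, Finset.sum_comm]
  simp [Matrix.trace, Matrix.mul_apply]

theorem matrix_norm_sq_eq_sum {n k : ℕ} (X : Matrix (Fin n) (Fin k) ℝ) :
    ‖X‖ ^ 2 = ∑ i, ∑ j, X i j ^ 2 := by
  rw [← real_inner_self_eq_norm_sq, matrix_inner_eq_sum]
  simp [sq]

theorem sum_mul_eq_of_mem_stiefelSet {n k : ℕ} {U : Matrix (Fin n) (Fin k) ℝ}
    (hU : U ∈ stiefelSet n k) (j l : Fin k) :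
    ∑ i, U i j * U i l = if j = l then 1 else 0 := by
  have h : Uᵀ * U = 1 := hU
  have h' := congrFun (congrFun h j) l
  rwa [Matrix.mul_apply, Matrix.one_apply] at h'

/-- A row of a nonnegative matrix with orthonormal columns has at most one non-zero entry. -/
theorem apply_mul_apply_eq_zero {n k : ℕ} {P : Matrix (Fin n) (Fin k) ℝ}
    (hP : P ∈ stiefelSet n k) (hP0 : ∀ i j, 0 ≤ P i j) {j l : Fin k} (hjl : j ≠ l) (i : Fin n) :
    P i j * P i l = 0 := by
  have h := sum_mul_eq_of_mem_stiefelSet hP j l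
  rw [if_neg hjl, Finset.sum_eq_zero_iff_of_nonneg
    (fun a _ => mul_nonneg (hP0 a j) (hP0 a l))] at h
  exact h i (Finset.mem_univ i)

theorem apply_le_one_of_mem_stiefelSet {n k : ℕ} {U : Matrix (Fin n) (Fin k) ℝ}
    (hU : U ∈ stiefelSet n k) (i : Fin n) (j : Fin k) : U i j ≤ 1 := by
  have h := sum_mul_eq_of_mem_stiefelSet hU j j
  rw [if_pos rfl] at h
  have h1 : U i j * U i j ≤ ∑ a, U a j * U a j :=
    Finset.single_le_sum (f := fun a => U a j * U a j) (fun a _ => mul_self_nonneg _)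
      (Finset.mem_univ i)
  exact (abs_le.1 (abs_le_one_iff_mul_self_le_one.2 (h1.trans h.le))).2

theorem negPartMatrix_nonneg {n k : ℕ} (U : Matrix (Fin n) (Fin k) ℝ) (i : Fin n) (j : Fin k) :
    0 ≤ negPartMatrix U i j := le_max_right _ _

theorem neg_apply_le_negPartMatrix {n k : ℕ} (U : Matrix (Fin n) (Fin k) ℝ) (i : Fin n)
    (j : Fin k) : -U i j ≤ negPartMatrix U i j := le_max_left _ _

/-- The sum of the entries of `U⁻`. -/
def negMass {n k : ℕ} (U : Matrix (Fin n) (Fin k) ℝ) : ℝ := ∑ i, ∑ j, negPartMatrix U i j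

theorem negMass_nonneg {n k : ℕ} (U : Matrix (Fin n) (Fin k) ℝ) : 0 ≤ negMass U :=
  Finset.sum_nonneg fun i _ => Finset.sum_nonneg fun j _ => negPartMatrix_nonneg U i j

theorem negMass_eq_zero {n k : ℕ} {U : Matrix (Fin n) (Fin k) ℝ} (hU : ∀ i j, 0 ≤ U i j) :
    negMass U = 0 :=
  Finset.sum_eq_zero fun i _ => Finset.sum_eq_zero fun j _ => max_eq_right (by linarith [hU i j])

theorem sum_col_negPartMatrix_le_negMass {n k : ℕ} (U : Matrix (Fin n) (Fin k) ℝ) (j : Fin k) :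
    ∑ i, negPartMatrix U i j ≤ negMass U :=
  Finset.sum_le_sum fun i _ => Finset.single_le_sum (f := fun b => negPartMatrix U i b)
    (fun b _ => negPartMatrix_nonneg U i b) (Finset.mem_univ j)

theorem negPartMatrix_le_negMass {n k : ℕ} (U : Matrix (Fin n) (Fin k) ℝ) (i : Fin n)
    (j : Fin k) : negPartMatrix U i j ≤ negMass U :=
  (Finset.single_le_sum (f := fun a => negPartMatrix U a j)
    (fun a _ => negPartMatrix_nonneg U a j) (Finset.mem_univ i)).trans
      (sum_col_negPartMatrix_le_negMass U j)

/-- An entry of `U` in the support of another column of `P` is almost nonpositive: since the columns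
of `U` and those of `P` are orthogonal, up to second order in `U - P` its positive part is paid for
by negative entries of `U`. -/
theorem mul_apply_le_negMass_add_sq {n k : ℕ} {P U : Matrix (Fin n) (Fin k) ℝ}
    (hP : P ∈ stiefelSet n k) (hP0 : ∀ i j, 0 ≤ P i j) (hU : U ∈ stiefelSet n k)
    {j l : Fin k} (hjl : j ≠ l) (i : Fin n) :
    P i j * U i l ≤ 2 * negMass U + ‖U - P‖ ^ 2 := by
  have hneg : ∀ a b c, 0 ≤ P a b * U a c + negPartMatrix U a c := fun a b c => by
    have h0 := hP0 a b
    have h1 := apply_le_one_of_mem_stiefelSet hP a b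
    have h2 := neg_apply_le_negPartMatrix U a c
    have h3 := negPartMatrix_nonneg U a c
    nlinarith [mul_nonneg h0 (by linarith : 0 ≤ U a c + negPartMatrix U a c),
      mul_nonneg (sub_nonneg.2 h1) h3]
  have h1 : P i j * U i l ≤ ∑ a, (P a j * U a l + negPartMatrix U a l) := by
    refine le_trans ?_ (Finset.single_le_sum (fun a _ => hneg a j l) (Finset.mem_univ i))
    linarith [negPartMatrix_nonneg U i l]
  have h2 : 0 ≤ ∑ a, (P a l * U a j + negPartMatrix U a j) :=
    Finset.sum_nonneg fun a _ => hneg a l j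
  have h3 : 0 ≤ ∑ a, ((U a j - P a j) * (U a l - P a l) + ∑ b, (U - P) a b ^ 2) := by
    refine Finset.sum_nonneg fun a _ => ?_
    have e1 : (U - P) a j ^ 2 ≤ ∑ b, (U - P) a b ^ 2 :=
      Finset.single_le_sum (f := fun b => (U - P) a b ^ 2) (fun b _ => sq_nonneg _)
        (Finset.mem_univ j)
    have e2 : (U - P) a l ^ 2 ≤ ∑ b, (U - P) a b ^ 2 :=
      Finset.single_le_sum (f := fun b => (U - P) a b ^ 2) (fun b _ => sq_nonneg _)
        (Finset.mem_univ l)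
    simp only [Matrix.sub_apply] at e1 e2 ⊢
    nlinarith [sq_nonneg ((U a j - P a j) + (U a l - P a l))]
  -- expand `⟨u_j, u_l⟩ = 0` around `P`, where `p_{aj} p_{al} = 0` for every row `a`
  have h4 : ∑ a, (P a j * U a l + P a l * U a j + (U a j - P a j) * (U a l - P a l)) = 0 := by
    have h := sum_mul_eq_of_mem_stiefelSet hU j l
    rw [if_neg hjl] at h
    rw [← h]
    refine Finset.sum_congr rfl fun a _ => ?_
    linear_combination apply_mul_apply_eq_zero hP hP0 hjl a
  rw [matrix_norm_sq_eq_sum]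
  have h5 := sum_col_negPartMatrix_le_negMass U j
  have h6 := sum_col_negPartMatrix_le_negMass U l
  simp only [Finset.sum_add_distrib] at h1 h2 h3 h4
  linarith

/-! ### The linear estimate by negative entries -/

/-- The sign conditions that describe the Fréchet normal cone of `St₊(n, k)` at `P`. -/
def NormalConeCondition {n k : ℕ} (P X : Matrix (Fin n) (Fin k) ℝ) : Prop :=
  ∀ i, ((∀ j, P i j = 0) → ∀ j, X i j ≤ 0) ∧ ((∃ j, P i j ≠ 0) → ∀ j, X i j * P i j = 0)

/-- The entrywise form of `exists_inner_sub_le`. The constant is independent of `U` and of order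
`|x_{ij}| / p_{il}` when the support of row `i` of `P` is `{l}`. -/
theorem exists_mul_sub_le {n k : ℕ} {P X : Matrix (Fin n) (Fin k) ℝ}
    (hP : P ∈ stiefelSet n k) (hP0 : ∀ i j, 0 ≤ P i j) (hX : NormalConeCondition P X)
    (i : Fin n) (j : Fin k) :
    ∃ c : ℝ, 0 ≤ c ∧ ∀ U ∈ stiefelSet n k,
      X i j * (U i j - P i j) ≤ c * (2 * negMass U + ‖U - P‖ ^ 2) := by
  by_cases h0 : ∀ l, P i l = 0
  · refine ⟨|X i j|, abs_nonneg _, fun U hU => ?_⟩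
    have hXij := (hX i).1 h0 j
    have h1 := neg_apply_le_negPartMatrix U i j
    have h2 := negPartMatrix_le_negMass U i j
    have h3 := negMass_nonneg U
    have h4 : 0 ≤ 2 * negMass U + ‖U - P‖ ^ 2 + U i j := by nlinarith [sq_nonneg ‖U - P‖]
    rw [h0 j, abs_of_nonpos hXij]
    nlinarith
  · push Not at h0
    obtain ⟨l, hl⟩ := h0
    have hXP := (hX i).2 ⟨l, hl⟩
    have hpos : 0 < P i l := (hP0 i l).lt_of_ne' hl
    rcases eq_or_ne l j with rfl | hlj
    · refine ⟨0, le_rfl, fun U _ => ?_⟩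
      rw [(mul_eq_zero.1 (hXP l)).resolve_right hl]
      simp
    · have hPij : P i j = 0 :=
        (mul_eq_zero.1 (apply_mul_apply_eq_zero hP hP0 hlj i)).resolve_left hl
      refine ⟨|X i j| / P i l, by positivity, fun U hU => ?_⟩
      have h1 := mul_apply_le_negMass_add_sq hP hP0 hU hlj i
      have h2 := neg_apply_le_negPartMatrix U i j
      have h3 := negPartMatrix_le_negMass U i j
      have h4 := negMass_nonneg U
      have h5 := apply_le_one_of_mem_stiefelSet hP i l
      have h6 : |P i l * U i j| ≤ 2 * negMass U + ‖U - P‖ ^ 2 :=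
        abs_le.2 ⟨by nlinarith [sq_nonneg ‖U - P‖, negPartMatrix_nonneg U i j], h1⟩
      rw [abs_mul, abs_of_pos hpos] at h6
      rw [hPij, sub_zero, div_mul_eq_mul_div, le_div_iff₀ hpos]
      calc X i j * U i j * P i l ≤ |X i j| * |U i j| * P i l :=
            mul_le_mul_of_nonneg_right ((le_abs_self _).trans_eq (abs_mul _ _)) hpos.le
        _ = |X i j| * (P i l * |U i j|) := by ring
        _ ≤ _ := mul_le_mul_of_nonneg_left h6 (abs_nonneg _)

/-- Along `St(n, k)`, the linear functional given by an `X` that satisfies the sign conditions is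
bounded by the negative entries, up to second order. -/
theorem exists_inner_sub_le {n k : ℕ} {P X : Matrix (Fin n) (Fin k) ℝ}
    (hP : P ∈ stiefelSet n k) (hP0 : ∀ i j, 0 ≤ P i j) (hX : NormalConeCondition P X) :
    ∃ C : ℝ, 0 ≤ C ∧ ∀ U ∈ stiefelSet n k,
      inner ℝ X (U - P) ≤ C * (2 * negMass U + ‖U - P‖ ^ 2) := by
  choose c hc0 hc using exists_mul_sub_le hP hP0 hX
  refine ⟨∑ i, ∑ j, c i j, Finset.sum_nonneg fun i _ => Finset.sum_nonneg fun j _ => hc0 i j,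
    fun U hU => ?_⟩
  rw [matrix_inner_eq_sum, Finset.sum_mul]
  refine Finset.sum_le_sum fun i _ => ?_
  rw [Finset.sum_mul]
  exact Finset.sum_le_sum fun j _ => hc i j U hU

theorem eventually_norm_stiefelExp_sub_sub_le {n k : ℕ} (P : Stiefel n k) {δ : ℝ} (hδ : 0 < δ) :
    ∀ᶠ V : stiefelTangent P.1 in 𝓝 0, ‖(stiefelExp P V).1 - P.1 - V.1‖ ≤ δ * ‖V‖ := by
  have h := (hasFDerivAt_iff_isLittleO.1 (hasFDerivAt_stiefelExp P)).def hδ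
  simpa [stiefelExp_zero] using h

theorem eventually_norm_stiefelExp_sub_le {n k : ℕ} (P : Stiefel n k) :
    ∀ᶠ V : stiefelTangent P.1 in 𝓝 0, ‖(stiefelExp P V).1 - P.1‖ ≤ 2 * ‖V‖ := by
  filter_upwards [eventually_norm_stiefelExp_sub_sub_le P one_pos] with V hV
  have h := norm_sub_norm_le ((stiefelExp P V).1 - P.1) V.1
  rw [Submodule.norm_coe] at h
  linarith

/-- First-order form of `exists_inner_sub_le` in exponential coordinates. -/
theorem exists_eventually_inner_le {n k : ℕ} {P : Stiefel n k} (hP0 : P ∈ stiefelNonneg n k)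
    {X : stiefelTangent P.1} (hX : NormalConeCondition P.1 X.1) :
    ∃ C : ℝ, ∀ ε > 0, ∀ᶠ V : stiefelTangent P.1 in 𝓝 0,
      inner ℝ X V ≤ C * negMass (stiefelExp P V).1 + ε * ‖V‖ := by
  obtain ⟨C, hC0, hC⟩ := exists_inner_sub_le P.2 hP0 hX
  refine ⟨2 * C, fun ε hε => ?_⟩
  -- half of `ε ‖V‖` absorbs the remainder `exp_P V - P - V`, the other half the term `C ‖U - P‖²`,
  -- which is at most `4 C ‖V‖²`
  have hδ : 0 < ε / (2 * (‖X.1‖ + 1)) := by positivity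
  have hr : 0 < ε / (8 * (C + 1)) := by positivity
  filter_upwards [eventually_norm_stiefelExp_sub_sub_le P hδ, eventually_norm_stiefelExp_sub_le P,
    Metric.closedBall_mem_nhds (0 : stiefelTangent P.1) hr] with V h1 h2 h3
  rw [mem_closedBall_zero_iff, le_div_iff₀ (by positivity)] at h3
  set U := (stiefelExp P V).1 with hUdef
  have h4 := hC U (stiefelExp P V).2
  have h5 : inner ℝ X.1 V.1 = inner ℝ X.1 (U - P.1) + inner ℝ X.1 (V.1 - (U - P.1)) := by
    rw [← inner_add_right]
    congr 1
    abel
  have h6 : inner ℝ X.1 (V.1 - (U - P.1)) ≤ ε / 2 * ‖V‖ := by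
    refine (real_inner_le_norm _ _).trans ?_
    rw [norm_sub_rev]
    refine (mul_le_mul_of_nonneg_left h1 (norm_nonneg _)).trans ?_
    rw [div_mul_eq_mul_div, mul_div_assoc', div_le_iff₀ (by positivity)]
    nlinarith [mul_nonneg hε.le (norm_nonneg V)]
  have h7 : C * ‖U - P.1‖ ^ 2 ≤ ε / 2 * ‖V‖ := by
    have e1 : ‖U - P.1‖ ^ 2 ≤ (2 * ‖V‖) ^ 2 := pow_le_pow_left₀ (norm_nonneg _) h2 2
    calc C * ‖U - P.1‖ ^ 2 ≤ (C + 1) * (2 * ‖V‖) ^ 2 := by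
          nlinarith [sq_nonneg (2 * ‖V‖)]
      _ = (‖V‖ * (8 * (C + 1))) * ‖V‖ / 2 := by ring
      _ ≤ ε / 2 * ‖V‖ := by nlinarith [mul_le_mul_of_nonneg_right h3 (norm_nonneg V)]
  rw [Submodule.coe_inner, h5]
  linarith

/-- The sign conditions are sufficient for membership in the Fréchet normal cone. -/
theorem NormalConeCondition.mem_stiefelNormalCone {n k : ℕ} {P : Stiefel n k}
    (hP0 : P ∈ stiefelNonneg n k) {X : stiefelTangent P.1} (hX : NormalConeCondition P.1 X.1) :
    X ∈ stiefelNormalCone (stiefelNonneg n k) P := by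
  obtain ⟨C, hC⟩ := exists_eventually_inner_le hP0 hX
  refine mem_frechetNormalCone_iff.2 fun ε hε => ?_
  filter_upwards [hC ε hε] with V hV hVΩ
  rw [negMass_eq_zero hVΩ, mul_zero, zero_add] at hV
  simpa using hV

/-! ### Subgradients of `f_β` on `St₊(n, k)` -/

theorem fBeta_eq_sum {n k : ℕ} {β : ℝ} (hβ : 0 < β) (U : Stiefel n k) :
    fBeta β U = ∑ i, ∑ j, negPartMatrix U.1 i j ^ β := by
  unfold fBeta entrywiseNorm
  rw [← Real.rpow_mul (by positivity), one_div_mul_cancel hβ.ne', Real.rpow_one]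
  simp_rw [abs_of_nonneg (negPartMatrix_nonneg U.1 _ _)]

theorem fBeta_eq_zero {n k : ℕ} {β : ℝ} (hβ : 0 < β) {P : Stiefel n k}
    (hP0 : P ∈ stiefelNonneg n k) : fBeta β P = 0 := by
  rw [fBeta_eq_sum hβ]
  refine Finset.sum_eq_zero fun i _ => Finset.sum_eq_zero fun j _ => ?_
  have h : negPartMatrix P.1 i j = 0 := max_eq_right (by linarith [hP0 i j])
  rw [h, Real.zero_rpow hβ.ne']

theorem tendsto_negPartMatrix_stiefelExp {n k : ℕ} {P : Stiefel n k}
    (hP0 : P ∈ stiefelNonneg n k) (i : Fin n) (j : Fin k) :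
    Filter.Tendsto (fun V : stiefelTangent P.1 => negPartMatrix (stiefelExp P V).1 i j)
      (𝓝 0) (𝓝 0) := by
  have h := (hasFDerivAt_stiefelExp P).continuousAt.tendsto
  rw [stiefelExp_zero] at h
  have h1 : Continuous fun U : Matrix (Fin n) (Fin k) ℝ => max (-U i j) 0 := by fun_prop
  have h2 := (h1.tendsto P.1).comp h
  rwa [max_eq_right (by linarith [hP0 i j])] at h2

theorem tendsto_negPartMatrix_stiefelExp_rpow {n k : ℕ} {P : Stiefel n k}
    (hP0 : P ∈ stiefelNonneg n k) (i : Fin n) (j : Fin k) {γ : ℝ} (hγ : 0 < γ) :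
    Filter.Tendsto (fun V : stiefelTangent P.1 => negPartMatrix (stiefelExp P V).1 i j ^ γ)
      (𝓝 0) (𝓝 0) := by
  have h := (tendsto_negPartMatrix_stiefelExp hP0 i j).rpow_const (p := γ) (Or.inr hγ.le)
  rwa [Real.zero_rpow hγ.ne'] at h

/-- For `β < 1`, the function `f_β` dominates every multiple of the sum of the negative parts. -/
theorem eventually_mul_negMass_le_fBeta {n k : ℕ} {P : Stiefel n k}
    (hP0 : P ∈ stiefelNonneg n k) {β : ℝ} (hβ0 : 0 < β) (hβ1 : β < 1) (C : ℝ) :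
    ∀ᶠ V : stiefelTangent P.1 in 𝓝 0,
      C * negMass (stiefelExp P V).1 ≤ fBeta β (stiefelExp P V) := by
  have h : ∀ i j, ∀ᶠ V : stiefelTangent P.1 in 𝓝 0,
      C * negPartMatrix (stiefelExp P V).1 i j ^ (1 - β) ≤ 1 := fun i j => by
    have h1 := (tendsto_negPartMatrix_stiefelExp_rpow hP0 i j (sub_pos.2 hβ1)).const_mul C
    rw [mul_zero] at h1
    exact h1.eventually_le_const one_pos
  filter_upwards [Filter.eventually_all.2 fun i => Filter.eventually_all.2 (h i)] with V hV
  rw [fBeta_eq_sum hβ0, negMass, Finset.mul_sum]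
  refine Finset.sum_le_sum fun i _ => ?_
  rw [Finset.mul_sum]
  refine Finset.sum_le_sum fun j _ => ?_
  set u := negPartMatrix (stiefelExp P V).1 i j with hu
  have hu0 : 0 ≤ u := negPartMatrix_nonneg _ i j
  have e : u = u ^ (1 - β) * u ^ β := by
    rw [← Real.rpow_add' hu0 (by simp), sub_add_cancel, Real.rpow_one]
  calc C * u = C * u ^ (1 - β) * u ^ β := by rw [mul_assoc, ← e]
    _ ≤ 1 * u ^ β := mul_le_mul_of_nonneg_right (hV i j) (Real.rpow_nonneg hu0 β)
    _ = u ^ β := one_mul _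

/-- For `β < 1`, every vector that satisfies the sign conditions is a Fréchet subgradient of `f_β`,
without any bound on its norm. -/
theorem NormalConeCondition.mem_stiefelSubdifferential {n k : ℕ} {P : Stiefel n k}
    (hP0 : P ∈ stiefelNonneg n k) {X : stiefelTangent P.1} (hX : NormalConeCondition P.1 X.1)
    {β : ℝ} (hβ0 : 0 < β) (hβ1 : β < 1) : X ∈ stiefelSubdifferential (fBeta β) P := by
  obtain ⟨C, hC⟩ := exists_eventually_inner_le hP0 hX
  refine mem_frechetSubdifferential_iff.2 fun ε hε => ?_
  filter_upwards [hC ε hε, eventually_mul_negMass_le_fBeta hP0 hβ0 hβ1 C] with V h1 h2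
  rw [stiefelExp_zero, fBeta_eq_zero hβ0 hP0]
  simp only [sub_zero, innerSL_apply_apply]
  linarith

theorem negPartMatrix_le_norm_sub {n k : ℕ} {P : Matrix (Fin n) (Fin k) ℝ}
    (hP0 : ∀ i j, 0 ≤ P i j) (U : Matrix (Fin n) (Fin k) ℝ) (i : Fin n) (j : Fin k) :
    negPartMatrix U i j ≤ ‖U - P‖ := by
  have h1 : (U - P) i j ^ 2 ≤ ‖U - P‖ ^ 2 := by
    rw [matrix_norm_sq_eq_sum]
    refine (Finset.single_le_sum (f := fun b => (U - P) i b ^ 2) (fun b _ => sq_nonneg _)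
      (Finset.mem_univ j)).trans ?_
    exact Finset.single_le_sum (f := fun a => ∑ b, (U - P) a b ^ 2)
      (fun a _ => Finset.sum_nonneg fun b _ => sq_nonneg _) (Finset.mem_univ i)
  have h2 := (abs_le.1 (abs_le_of_sq_le_sq h1 (norm_nonneg _))).1
  rw [Matrix.sub_apply] at h2
  exact max_le (by linarith [hP0 i j]) (norm_nonneg _)

/-- For `β > 1`, the function `f_β` vanishes to first order on `St₊(n, k)`. -/
theorem eventually_fBeta_le {n k : ℕ} {P : Stiefel n k} (hP0 : P ∈ stiefelNonneg n k)
    {β : ℝ} (hβ : 1 < β) {ε : ℝ} (hε : 0 < ε) :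
    ∀ᶠ V : stiefelTangent P.1 in 𝓝 0, fBeta β (stiefelExp P V) ≤ ε * ‖V‖ := by
  have hη : 0 < ε / (2 * (n * k + 1)) := by positivity
  have h : ∀ i j, ∀ᶠ V : stiefelTangent P.1 in 𝓝 0,
      negPartMatrix (stiefelExp P V).1 i j ^ (β - 1) ≤ ε / (2 * (n * k + 1)) := fun i j =>
    (tendsto_negPartMatrix_stiefelExp_rpow hP0 i j (sub_pos.2 hβ)).eventually_le_const hη
  filter_upwards [Filter.eventually_all.2 fun i => Filter.eventually_all.2 (h i),
    eventually_norm_stiefelExp_sub_le P] with V hV hV2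
  rw [fBeta_eq_sum (one_pos.trans hβ)]
  -- each of the `n k` summands is at most `ε ‖V‖ / (n k + 1)`
  have h1 : ∀ i j, negPartMatrix (stiefelExp P V).1 i j ^ β ≤
      ε / (2 * (n * k + 1)) * (2 * ‖V‖) := fun i j => by
    set u := negPartMatrix (stiefelExp P V).1 i j with hu
    have hu0 : 0 ≤ u := negPartMatrix_nonneg _ i j
    have e : u ^ β = u ^ (β - 1) * u := by
      rw [← Real.rpow_add_one' hu0 (by linarith), sub_add_cancel]
    rw [e]
    exact mul_le_mul (hV i j) ((negPartMatrix_le_norm_sub hP0 _ i j).trans hV2) hu0 hη.le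
  calc ∑ i, ∑ j, negPartMatrix (stiefelExp P V).1 i j ^ β
      ≤ ∑ _i : Fin n, ∑ _j : Fin k, ε / (2 * (n * k + 1)) * (2 * ‖V‖) :=
        Finset.sum_le_sum fun i _ => Finset.sum_le_sum fun j _ => h1 i j
    _ = (n * k) / (n * k + 1) * (ε * ‖V‖) := by
        simp only [Finset.sum_const, Finset.card_univ, Fintype.card_fin, nsmul_eq_mul]
        field_simp
    _ ≤ 1 * (ε * ‖V‖) := by
        refine mul_le_mul_of_nonneg_right ?_ (by positivity)
        rw [div_le_one (by positivity)]
        linarith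
    _ = ε * ‖V‖ := one_mul _

/-- Testing a subgradient `X` of `f_β` in its own direction leaves no room for `X ≠ 0`, as `f_β` is
`o(‖V‖)` for `β > 1`. -/
theorem eq_zero_of_mem_stiefelSubdifferential {n k : ℕ} {P : Stiefel n k}
    (hP0 : P ∈ stiefelNonneg n k) {β : ℝ} (hβ : 1 < β) {X : stiefelTangent P.1}
    (hX : X ∈ stiefelSubdifferential (fBeta β) P) : X = 0 := by
  have h : ∀ ε > 0, ‖X‖ ^ 2 ≤ ε * ‖X‖ := fun ε hε => by
    have h1 := (mem_frechetSubdifferential_iff.1 hX (ε / 2) (half_pos hε)).and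
      (eventually_fBeta_le hP0 hβ (half_pos hε))
    have h2 : Filter.Tendsto (fun t : ℝ => t • X) (𝓝[>] 0) (𝓝 0) := by
      have : Continuous fun t : ℝ => t • X := by fun_prop
      simpa using (this.tendsto 0).mono_left nhdsWithin_le_nhds
    obtain ⟨t, ⟨ht1, ht2⟩, ht⟩ := ((h2.eventually h1).and self_mem_nhdsWithin).exists
    have ht0 : 0 < t := ht
    rw [stiefelExp_zero, fBeta_eq_zero (one_pos.trans hβ) hP0] at ht1
    have hinner : inner ℝ X (t • X) = t * ‖X‖ ^ 2 :=
      (real_inner_smul_right X X t).trans (by rw [real_inner_self_eq_norm_sq])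
    simp only [sub_zero, innerSL_apply_apply, hinner, norm_smul,
      Real.norm_of_nonneg ht0.le] at ht1 ht2
    have h3 : t * ‖X‖ ^ 2 ≤ t * (ε * ‖X‖) := by linarith
    exact le_of_mul_le_mul_left h3 ht0
  by_contra hne
  have hpos := norm_pos_iff.2 hne
  nlinarith [h (‖X‖ / 2) (half_pos hpos)]

/-! ### Necessity of the sign conditions -/

/-- If `W` is orthogonal to the columns of `P` and `Wᵀ W = E` is a symmetric projection with
`W E = W`, then the geodesic from `P` with velocity `W` rotates the columns of `P` in the range of
`E` towards those of `W` and keeps the others fixed. -/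
theorem stiefelGeodesic_eq_rotation {n k : ℕ} {P W : Matrix (Fin n) (Fin k) ℝ}
    {E : Matrix (Fin k) (Fin k) ℝ} (hP : P ∈ stiefelSet n k) (hE : Eᵀ = E) (hEE : E * E = E)
    (hPW : Pᵀ * W = 0) (hWW : Wᵀ * W = E) (hWE : W * E = W) (t : ℝ) :
    stiefelGeodesic P W t = P + (Real.cos t - 1) • (P * E) + Real.sin t • W := by
  have hP' : Pᵀ * P = 1 := hP
  have hWP : Wᵀ * P = 0 := by
    rw [← Matrix.transpose_transpose P, ← Matrix.transpose_mul, hPW, Matrix.transpose_zero]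
  set γ : ℝ → Matrix (Fin n) (Fin k) ℝ :=
    fun t => P + (Real.cos t - 1) • (P * E) + Real.sin t • W with hγ
  have h1 : deriv γ = fun t => (-Real.sin t) • (P * E) + Real.cos t • W := funext fun t =>
    ((((Real.hasDerivAt_cos t).sub_const 1).smul_const (P * E)).const_add P |>.add
      ((Real.hasDerivAt_sin t).smul_const W)).deriv
  have h2 : deriv (deriv γ) = fun t => (-Real.cos t) • (P * E) + (-Real.sin t) • W := by
    rw [h1]
    exact funext fun t => (((Real.hasDerivAt_sin t).neg.smul_const (P * E)).add
      ((Real.hasDerivAt_cos t).smul_const W)).deriv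
  have hgeo : IsStiefelGeodesic γ := by
    refine ⟨fun t => ?_, ?_, fun t X hX => ?_⟩
    · change (γ t)ᵀ * γ t = 1
      have e1 : Pᵀ * (P * E) = E := by rw [← Matrix.mul_assoc, hP', Matrix.one_mul]
      have e2 : Wᵀ * (P * E) = 0 := by rw [← Matrix.mul_assoc, hWP, Matrix.zero_mul]
      simp only [hγ, Matrix.transpose_add, Matrix.transpose_smul, Matrix.transpose_mul, hE,
        Matrix.add_mul, Matrix.mul_add, Matrix.smul_mul, Matrix.mul_smul, Matrix.mul_assoc, hP',
        hPW, hWP, hWW, e1, e2, hEE, Matrix.mul_one, Matrix.mul_zero, smul_zero, add_zero,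
        zero_add, smul_smul]
      match_scalars
      · ring
      · linear_combination Real.sin_sq_add_cos_sq t
    · exact ((contDiff_const.add ((Real.contDiff_cos.sub contDiff_const).smul contDiff_const)).add
        (Real.contDiff_sin.smul contDiff_const))
    · -- the acceleration `-γ E` is normal to the manifold, as `E` is symmetric
      have e : deriv (deriv γ) t = γ t * (-E) := by
        rw [h2]
        simp only [hγ, Matrix.mul_neg, Matrix.add_mul, Matrix.smul_mul, Matrix.mul_assoc, hEE, hWE]
        module
      rw [e]
      exact inner_mul_symm_eq_zero (by rw [Matrix.transpose_neg, hE]) hX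
  have h := hgeo.eq_stiefelGeodesic t
  have h0 : γ 0 = P := by simp [hγ]
  have h0' : deriv γ 0 = W := by simp [h1]
  rw [h0, h0'] at h
  exact h.symm

/-- A normal vector makes an obtuse angle with the velocity of every geodesic that starts inside
`St₊(n, k)`. -/
theorem inner_nonpos_of_mem_stiefelNormalCone {n k : ℕ} {P : Stiefel n k}
    {X W : stiefelTangent P.1} (hX : X ∈ stiefelNormalCone (stiefelNonneg n k) P)
    (hW : ∀ᶠ t in 𝓝[>] (0 : ℝ), ∀ i j, 0 ≤ stiefelGeodesic P.1 W.1 t i j) :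
    inner ℝ X W ≤ 0 := by
  have h : ∀ ε > 0, inner ℝ X W ≤ ε * ‖W‖ := fun ε hε => by
    have h1 := mem_frechetNormalCone_iff.1 hX ε hε
    have h2 : Filter.Tendsto (fun t : ℝ => t • W) (𝓝[>] 0) (𝓝 0) := by
      have : Continuous fun t : ℝ => t • W := by fun_prop
      simpa using (this.tendsto 0).mono_left nhdsWithin_le_nhds
    obtain ⟨t, ⟨ht1, ht2⟩, ht⟩ := (((h2.eventually h1).and hW).and self_mem_nhdsWithin).exists
    have ht0 : 0 < t := ht
    have hmem : stiefelExp P (t • W) ∈ stiefelNonneg n k := fun i j => by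
      rw [stiefelExp_smul]
      exact ht2 i j
    have h3 := ht1 hmem
    have hinner : inner ℝ X (t • W) = t * inner ℝ X W := real_inner_smul_right X W t
    rw [sub_zero, innerSL_apply_apply, hinner, norm_smul,
      Real.norm_of_nonneg ht0.le, mul_left_comm] at h3
    exact le_of_mul_le_mul_left h3 ht0
  by_contra! hpos
  have hWpos : 0 < ‖W‖ := norm_pos_iff.2 fun h0 => by simp [h0] at hpos
  have h1 := h (inner ℝ X W / (2 * ‖W‖)) (by positivity)
  have h2 : inner ℝ X W / (2 * ‖W‖) * ‖W‖ = inner ℝ X W / 2 := by field_simp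
  linarith

/-- The normal cone tested on the geodesic that rotates column `j` of `P` towards the unit vector
`w`; its velocity is `w e_jᵀ`. -/
theorem sum_mul_nonpos_of_unit {n k : ℕ} {P : Stiefel n k} (hP0 : P ∈ stiefelNonneg n k)
    {X : stiefelTangent P.1} (hX : X ∈ stiefelNormalCone (stiefelNonneg n k) P) (j : Fin k)
    {w : Fin n → ℝ} (hPw : ∀ l, ∑ i, P.1 i l * w i = 0) (hw0 : ∀ i, P.1 i j = 0 → 0 ≤ w i)
    (hw : ∑ i, w i * w i = 1) : ∑ i, X.1 i j * w i ≤ 0 := by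
  set W : Matrix (Fin n) (Fin k) ℝ := Matrix.of fun i l => if l = j then w i else 0 with hWdef
  set E : Matrix (Fin k) (Fin k) ℝ := Matrix.single j j 1 with hEdef
  have hPW : P.1ᵀ * W = 0 := by
    ext a b
    by_cases hb : b = j <;> simp [Matrix.mul_apply, hWdef, hb, hPw]
  have hWP : Wᵀ * P.1 = 0 := by
    rw [← Matrix.transpose_transpose P.1, ← Matrix.transpose_mul, hPW, Matrix.transpose_zero]
  have hWT : W ∈ stiefelTangent P.1 := by
    change Wᵀ * P.1 + P.1ᵀ * W = 0
    rw [hWP, hPW, add_zero]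
  have hWW : Wᵀ * W = E := by
    ext a b
    simp only [Matrix.mul_apply, hWdef, hEdef, Matrix.single_apply, @eq_comm _ j,
      Matrix.transpose_apply, Matrix.of_apply]
    by_cases ha : a = j <;> by_cases hb : b = j <;> simp [ha, hb, hw]
  have hWE : W * E = W := by
    ext a b
    by_cases hb : b = j
    · simp [hWdef, hEdef, hb]
    · simp [hWdef, hEdef, hb]
  have hgeo : ∀ t, stiefelGeodesic P.1 W t =
      P.1 + (Real.cos t - 1) • (P.1 * E) + Real.sin t • W :=
    stiefelGeodesic_eq_rotation P.2 (by simp [hEdef]) (by simp [hEdef]) hPW hWW hWE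
  have hpos : ∀ i l, ∀ᶠ t in 𝓝[>] (0 : ℝ), 0 ≤ stiefelGeodesic P.1 W t i l := fun i l => by
    by_cases hl : l = j
    · subst hl
      have he : ∀ t, stiefelGeodesic P.1 W t i l =
          Real.cos t * P.1 i l + Real.sin t * w i := fun t => by
        rw [hgeo]
        simp [hWdef, hEdef]
        ring
      simp only [he]
      rcases (hP0 i l).eq_or_lt with h0 | h0
      · filter_upwards [Ioo_mem_nhdsGT Real.pi_pos] with t ht
        rw [← h0, mul_zero, zero_add]
        exact mul_nonneg (Real.sin_pos_of_mem_Ioo ht).le (hw0 i h0.symm)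
      · have hc : Continuous fun t => Real.cos t * P.1 i l + Real.sin t * w i := by fun_prop
        have h1 := (hc.tendsto 0).mono_left (nhdsWithin_le_nhds (s := Set.Ioi 0))
        simp only [Real.cos_zero, Real.sin_zero, one_mul, zero_mul, add_zero] at h1
        exact h1.eventually_const_le h0
    · refine Filter.Eventually.of_forall fun t => ?_
      have he : stiefelGeodesic P.1 W t i l = P.1 i l := by
        rw [hgeo]
        simp [hWdef, hEdef, hl]
      rw [he]
      exact hP0 i l
  have h := inner_nonpos_of_mem_stiefelNormalCone (W := ⟨W, hWT⟩) hX
    (Filter.eventually_all.2 fun i => Filter.eventually_all.2 (hpos i))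
  rw [Submodule.coe_inner, matrix_inner_eq_sum] at h
  simpa [hWdef] using h

theorem sum_mul_nonpos_of_mem_stiefelNormalCone {n k : ℕ} {P : Stiefel n k}
    (hP0 : P ∈ stiefelNonneg n k) {X : stiefelTangent P.1}
    (hX : X ∈ stiefelNormalCone (stiefelNonneg n k) P) (j : Fin k) {w : Fin n → ℝ}
    (hPw : ∀ l, ∑ i, P.1 i l * w i = 0) (hw0 : ∀ i, P.1 i j = 0 → 0 ≤ w i) :
    ∑ i, X.1 i j * w i ≤ 0 := by
  rcases (Finset.sum_nonneg fun i _ => mul_self_nonneg (w i) :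
    0 ≤ ∑ i, w i * w i).eq_or_lt with h0 | h0
  · have hw : ∀ i, w i = 0 := fun i => mul_self_eq_zero.1
      ((Finset.sum_eq_zero_iff_of_nonneg fun i _ => mul_self_nonneg (w i)).1 h0.symm i
        (Finset.mem_univ i))
    simp [hw]
  · set r := √(∑ i, w i * w i) with hr
    have hr0 : 0 < r := Real.sqrt_pos.2 h0
    have hrr : r * r = ∑ i, w i * w i := Real.mul_self_sqrt h0.le
    have h := sum_mul_nonpos_of_unit hP0 hX j (w := fun i => w i / r)
      (fun l => by simp only [mul_div_assoc', ← Finset.sum_div, hPw, zero_div])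
      (fun i hi => div_nonneg (hw0 i hi) hr0.le)
      (by simp only [div_mul_div_comm, ← Finset.sum_div, hrr, div_self h0.ne'])
    simp only [mul_div_assoc', ← Finset.sum_div] at h
    by_contra! hpos
    exact absurd h (not_le.2 (div_pos hpos hr0))

/-- The sign conditions are necessary for membership in the Fréchet normal cone. -/
theorem normalConeCondition_of_mem_stiefelNormalCone {n k : ℕ} {P : Stiefel n k}
    (hP0 : P ∈ stiefelNonneg n k) {X : stiefelTangent P.1}
    (hX : X ∈ stiefelNormalCone (stiefelNonneg n k) P) : NormalConeCondition P.1 X.1 := by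
  refine fun i => ⟨fun h0 j => ?_, fun _ j => ?_⟩
  · -- rotate column `j` towards the coordinate vector of the zero row
    have h := sum_mul_nonpos_of_mem_stiefelNormalCone hP0 hX j (w := Pi.single i 1)
      (fun l => by simp [Pi.single_apply, h0])
      (fun a _ => by by_cases ha : a = i <;> simp [ha])
    simpa [Pi.single_apply] using h
  · -- rotate column `j` of `P` within its support, towards the column `j` of `X` restricted to it
    set w : Fin n → ℝ := fun a => if P.1 a j = 0 then 0 else X.1 a j with hw
    have hPX : P.1ᵀ * X.1 = -(X.1ᵀ * P.1) := eq_neg_of_add_eq_zero_right X.2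
    have hPXj : ∑ a, P.1 a j * X.1 a j = 0 := by
      have h := congrFun (congrFun hPX j) j
      simp only [Matrix.neg_apply, Matrix.mul_apply, Matrix.transpose_apply] at h
      simp only [mul_comm (X.1 _ j)] at h
      linarith
    have hPw : ∀ l, ∑ a, P.1 a l * w a = 0 := fun l => by
      by_cases hl : l = j
      · rw [← hPXj, hl]
        refine Finset.sum_congr rfl fun a _ => ?_
        by_cases ha : P.1 a j = 0 <;> simp [hw, ha]
      · refine Finset.sum_eq_zero fun a _ => ?_
        by_cases ha : P.1 a j = 0
        · simp [hw, ha]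
        · rw [(mul_eq_zero.1 (apply_mul_apply_eq_zero P.2 hP0 hl a)).resolve_right ha, zero_mul]
    have h := sum_mul_nonpos_of_mem_stiefelNormalCone hP0 hX j hPw (fun a ha => by simp [hw, ha])
    have hsq : ∀ a, X.1 a j * w a = w a * w a := fun a => by
      by_cases ha : P.1 a j = 0 <;> simp [hw, ha]
    simp only [hsq] at h
    have h0 := (Finset.sum_eq_zero_iff_of_nonneg fun a _ => mul_self_nonneg (w a)).1
      (le_antisymm h (Finset.sum_nonneg fun a _ => mul_self_nonneg (w a))) i (Finset.mem_univ i)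
    have hwi : w i = 0 := mul_self_eq_zero.1 h0
    by_cases hi : P.1 i j = 0
    · rw [hi, mul_zero]
    · simp only [hw, if_neg hi] at hwi
      rw [hwi, zero_mul]

/-! ### A point with nontrivial normal cone -/

/-- At `P = [I; 0]` the normal cone of `St₊(n, k)` is nontrivial: it contains
`[k ≥ 2] • e₀ e₁ᵀ - e₁ e₀ᵀ`. -/
theorem exists_normalConeCondition_ne_zero {n k : ℕ} (hk : 0 < k) (hkn : k ≤ n) (hn : 2 ≤ n) :
    ∃ P ∈ stiefelNonneg n k, ∃ X : stiefelTangent P.1, NormalConeCondition P.1 X.1 ∧ X ≠ 0 := by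
  set P : Matrix (Fin n) (Fin k) ℝ := Matrix.of fun i j => if i.1 = j.1 then 1 else 0 with hP
  have hmul : ∀ (Y : Matrix (Fin n) (Fin k) ℝ) (j l : Fin k),
      (Pᵀ * Y) j l = Y (Fin.castLE hkn j) l := fun Y j l => by
    rw [Matrix.mul_apply, Finset.sum_eq_single (Fin.castLE hkn j)]
    · simp [hP]
    · intro a _ ha
      have : a.1 ≠ j.1 := fun h => ha (Fin.ext h)
      simp [hP, this]
    · simp
  have hPmem : P ∈ stiefelSet n k := by
    change Pᵀ * P = 1
    ext j l
    rw [hmul, Matrix.one_apply]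
    simp [hP, Fin.ext_iff]
  set X : Matrix (Fin n) (Fin k) ℝ := Matrix.of fun i j =>
    if i.1 = 1 ∧ j.1 = 0 then -1 else if i.1 = 0 ∧ j.1 = 1 then 1 else 0 with hX
  have hXT : X ∈ stiefelTangent P := by
    change Xᵀ * P + Pᵀ * X = 0
    have e : Xᵀ * P = (Pᵀ * X)ᵀ := by rw [Matrix.transpose_mul, Matrix.transpose_transpose]
    rw [e]
    ext j l
    rw [Matrix.add_apply, Matrix.transpose_apply, hmul, hmul]
    simp only [hX, Matrix.of_apply, Fin.val_castLE, Matrix.zero_apply]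
    split_ifs <;> first | omega | norm_num
  refine ⟨⟨P, hPmem⟩, fun i j => ?_, ⟨X, hXT⟩, fun i => ⟨fun h0 j => ?_, fun _ j => ?_⟩, fun h => ?_⟩
  · by_cases h : i.1 = j.1 <;> simp [hP, h]
  · have hi : i.1 ≠ 0 := fun h => by simpa [hP, h] using h0 ⟨0, hk⟩
    simp only [hX, Matrix.of_apply]
    split_ifs <;> first | omega | norm_num
  · simp only [hX, hP, Matrix.of_apply]
    split_ifs <;> first | omega | norm_num
  · have h1 := congrFun (congrFun (congrArg Subtype.val h) ⟨1, hn⟩) ⟨0, hk⟩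
    simp [hX] at h1

theorem mainTheorem8 (n k : ℕ) (hk : 0 < k) (hkn : k ≤ n) :
    (∀ P ∈ stiefelNonneg n k, ∀ X : stiefelTangent P.1,
      X ∈ stiefelNormalCone (stiefelNonneg n k) P ↔
        ∀ i, ((∀ j, P.1 i j = 0) → ∀ j, X.1 i j ≤ 0) ∧
          ((∃ j, P.1 i j ≠ 0) → ∀ j, X.1 i j * P.1 i j = 0)) ∧
    (∀ β : ℝ, 0 < β → β < 1 → ∀ P ∈ stiefelNonneg n k, DualNecessaryCondition β 1 P) ∧
    (2 ≤ n → ∀ β : ℝ, 1 < β → ∃ P ∈ stiefelNonneg n k, ∀ α : ℝ, 0 < α →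
      ¬ DualNecessaryCondition β α P) := by
  refine ⟨fun P hP0 X => ⟨normalConeCondition_of_mem_stiefelNormalCone hP0,
    NormalConeCondition.mem_stiefelNormalCone hP0⟩, fun β hβ0 hβ1 P hP0 X hX =>
    (normalConeCondition_of_mem_stiefelNormalCone hP0 hX.2).mem_stiefelSubdifferential hP0 hβ0 hβ1,
    fun hn β hβ => ?_⟩
  obtain ⟨P, hP0, X, hX, hX0⟩ := exists_normalConeCondition_ne_zero hk hkn hn
  refine ⟨P, hP0, fun α hα h => ?_⟩
  have hpos := norm_pos_iff.2 hX0
  -- the normal cone is a cone, so `X` can be scaled to have norm `α`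
  have hc : 0 < α / ‖X‖ := div_pos hα hpos
  have hcX : NormalConeCondition P.1 ((α / ‖X‖) • X).1 := fun i => by
    refine ⟨fun h0 j => ?_, fun h0 j => ?_⟩
    · exact mul_nonpos_of_nonneg_of_nonpos hc.le ((hX i).1 h0 j)
    · change α / ‖X‖ * X.1 i j * P.1 i j = 0
      rw [mul_assoc, (hX i).2 h0 j, mul_zero]
  have hmem : (α / ‖X‖) • X ∈ Metric.closedBall (0 : stiefelTangent P.1) α := by
    rw [mem_closedBall_zero_iff, norm_smul, Real.norm_of_nonneg hc.le, div_mul_cancel₀ _ hpos.ne']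
  exact smul_ne_zero hc.ne' hX0 (eq_zero_of_mem_stiefelSubdifferential hP0 hβ
    (h ⟨hmem, hcX.mem_stiefelNormalCone hP0⟩))
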